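/- Let $K$ be a field and let $q\in K$ satisfy $q\neq 0$ and $1+q^j\neq 0$ for all $j\ge 1$. Write $[n]=1+q+\cdots+q^{n-1}$, and let $\begin{bmatrix} n\\k\end{bmatrix}$ be the Gaussian binomial coefficient (the polynomial in $q$ given by the $q$-Pascal rule, evaluated at $q\in K$). Put $$a(n)=\begin{bmatrix}2n\\n\end{bmatrix}\frac{1}{\prod_{j=1}^{n}(1+q^j)^2},\qquad r(n,x)=\sum_{k=0}^{n}a(n-k)x^k,\qquad d(n,x)=\det\bigl(r(i+j,x)\bigr)_{i,j=0}^{n}.$$ Define $F_n(x,b,s,q)$ by $F_0=0$, $F_1=1$ and, for $n\ge 2$, $$F_n(x,b,s,q)=xF_{n-1}(x,b,s,q)+\frac{q^{n-3}s}{(1-q^{n-2}b)(1-q^{n-1}b)}F_{n-2}(x,b,s,q),$$ where the second summand is read as $0$ for $n=2$, and, when $[j]\ne0$ for all $j\ge1$, define the $q$-Lucas polynomials for $n\ge1$ by $$L_n(x,s,q)=\sum_{k=0}^{\lfloor n/2\rfloor}q^{k^2-k}s^k\,\frac{[n]}{[n-k]}\begin{bmatrix}n-k\\k\end{bmatrix}\frac{x^{n-2k}}{\prod_{j=1}^{k}(1+q^j)\prod_{j=n-k}^{n-1}(1+q^j)}.$$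 (1) Suppose in addition that $[j]\neq0$ for all $j\ge1$, and put $p_0=1$, $p_n(x)=L_n(x,-1,q)$ for $n\ge1$. Then there is exactly one linear functional $\Lambda$ on $K[x]$ with $\Lambda(p_0)=1$ and $\Lambda(p_n)=0$ for $n\geq 1$; the polynomials $p_n$ are orthogonal with respect to it, that is, $\Lambda(p_np_m)=0$ for $n\neq m$; and its even moments are $\Lambda(x^{2n})=a(n)$ for all $n\ge0$. (2) For all $n\ge0$ we have $d(n,0)\neq0$, and for all $x\in K$ $$\frac{d(n,x^2)}{d(n,0)}=\frac{(-1)^n}{q^{n^2}}\prod_{j=1}^{2n}(1+q^j)\;F_{2n+1}(x,-1,-q,q).$$ -/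

import Mathlib

open Polynomial

/-- The `q`-number `[n] = 1 + q + ⋯ + q^(n-1)`. -/
def qNumber {K : Type*} [Field K] (q : K) (n : ℕ) : K :=
  ∑ i ∈ Finset.range n, q ^ i

/-- The Gaussian binomial coefficient `[n choose k]`, a polynomial in `q` evaluated at an element
of a field, given by the `q`-Pascal rule. -/
def qBinomial {K : Type*} [Field K] (q : K) : ℕ → ℕ → K
  | _, 0 => 1
  | 0, _ + 1 => 0
  | n + 1, k + 1 => qBinomial q n k + q ^ (k + 1) * qBinomial q n (k + 1)

/-- The polynomials `r(n, x) = ∑_{k=0}^n a(n-k) x^k` attached to a sequence `a`. -/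
def convPoly {K : Type*} [Field K] (a : ℕ → K) (n : ℕ) (x : K) : K :=
  ∑ k ∈ Finset.range (n + 1), a (n - k) * x ^ k

/-- The Hankel determinant `d(n, x) = det (r(i + j, x))_{i,j=0}^n`. -/
def hankelDet {K : Type*} [Field K] (a : ℕ → K) (n : ℕ) (x : K) : K :=
  (Matrix.of fun i j : Fin (n + 1) => convPoly a ((i : ℕ) + (j : ℕ)) x).det

/-- The `(q, b)`-Fibonacci polynomials `F_n(x, b, s, q)`. In the recursion for `F_2` the second
summand is a multiple of `F_0 = 0`. -/
def qbFib {K : Type*} [Field K] (x b s q : K) : ℕ → K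
  | 0 => 0
  | 1 => 1
  | n + 2 => x * qbFib x b s q (n + 1) +
      q ^ ((n : ℤ) - 1) * s / ((1 - q ^ n * b) * (1 - q ^ (n + 1) * b)) * qbFib x b s q n

/-- The generalized `q`-Lucas polynomials `L_n(x, s, q)` as polynomials in `x`, with `L_0 = 2`. -/
noncomputable def qLucas {K : Type*} [Field K] (s q : K) (n : ℕ) : K[X] :=
  if n = 0 then 2 else
    ∑ k ∈ Finset.range (n / 2 + 1),
      C (q ^ (k ^ 2 - k) * s ^ k * (qNumber q n / qNumber q (n - k)) * qBinomial q (n - k) k /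
        ((∏ j ∈ Finset.Icc 1 k, (1 + q ^ j)) * ∏ j ∈ Finset.Ico (n - k) n, (1 + q ^ j))) *
      X ^ (n - 2 * k)

/-- The monic polynomials `p_0 = 1` and `p_n = L_n(x, -1, q)` for `n > 0`. -/
noncomputable def qLucasOrtho {K : Type*} [Field K] (q : K) (n : ℕ) : K[X] :=
  if n = 0 then 1 else qLucas (-1) q n

/-- The numbers `a(n) = [2n choose n] / ∏_{j=1}^n (1 + q^j)^2`. -/
def qCentral {K : Type*} [Field K] (q : K) (n : ℕ) : K :=
  qBinomial q (2 * n) n / ∏ j ∈ Finset.Icc 1 n, (1 + q ^ j) ^ 2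

/-! Everything comes from one three-term recurrence `P_{n+2} = X P_{n+1} - c_n P_n` with `c =
qLucasCoeff q`. Its moments are the column-zero entries of the `stieltjes` table, whose closed form
(`stieltjes_qLucasCoeff`) follows from the two q-Pascal rules; the even moments are `qCentral`. For
(1), `p_n = P_n` is checked coefficientwise (`coeff_favardPoly_qLucasCoeff`), and only there are the
`[j] ≠ 0` needed.

For (2), with odd moments zero, `r(j, x²)` is an odd moment of the second-kind functional at `x`,
which sends `P_n` to the associated polynomial. Row operations leave `r` only in the first row of
the Hankel matrix. Multiplying by the unitriangular matrix of coefficients of the `P_{2k+1}` puts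
associated polynomials in that row and, by orthogonality, a triangular block below it. Hence the
determinant is a constant times the associated polynomial of index `2n+1` (`hankelDet_stieltjes`),
which is the Fibonacci polynomial. Dividing by the value at `0` removes the constant. -/

/-- The monic polynomials with `P₀ = 1`, `P₁ = X` and `P_{n+2} = X P_{n+1} - c_n P_n`. -/
noncomputable def favardPoly {K : Type*} [Field K] (c : ℕ → K) : ℕ → K[X]
  | 0 => 1
  | 1 => X
  | n + 2 => X * favardPoly c (n + 1) - C (c n) * favardPoly c n

/-- The coefficient of the `k`-th orthogonal polynomial in the expansion of `X ^ n`. -/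
def stieltjes {K : Type*} [Field K] (c : ℕ → K) : ℕ → ℕ → K
  | 0, 0 => 1
  | 0, _ + 1 => 0
  | n + 1, 0 => c 0 * stieltjes c n 1
  | n + 1, k + 1 => stieltjes c n k + c (k + 1) * stieltjes c n (k + 2)

/-- The linear functional on polynomials with prescribed moments. -/
noncomputable def momentFunctional {K : Type*} [Field K] (μ : ℕ → K) : K[X] →ₗ[K] K :=
  (Polynomial.basisMonomials K).constr K μ

/-! ### Orthogonality and moments from a three-term recurrence. -/

section Favard

variable {K : Type*} [Field K] (c : ℕ → K)

theorem momentFunctional_X_pow (μ : ℕ → K) (n : ℕ) : momentFunctional μ (X ^ n) = μ n := by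
  rw [← monomial_one_right_eq_X_pow]
  exact (Polynomial.basisMonomials K).constr_basis K μ n

theorem stieltjes_eq_zero_of_lt {n k : ℕ} (h : n < k) : stieltjes c n k = 0 := by
  induction n generalizing k with
  | zero => obtain ⟨k, rfl⟩ := Nat.exists_eq_succ_of_ne_zero h.ne'; rfl
  | succ n ih =>
    obtain ⟨k, rfl⟩ := Nat.exists_eq_succ_of_ne_zero (Nat.ne_zero_of_lt h)
    rw [stieltjes, ih (by omega), ih (by omega)]; simp

theorem stieltjes_self (n : ℕ) : stieltjes c n n = 1 := by
  induction n with
  | zero => rfl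
  | succ n ih => rw [stieltjes, ih, stieltjes_eq_zero_of_lt c (by omega)]; simp

theorem stieltjes_eq_zero_of_odd {n k : ℕ} (h : Odd (n + k)) : stieltjes c n k = 0 := by
  induction n generalizing k with
  | zero => cases k with
    | zero => simp at h
    | succ k => rfl
  | succ n ih => cases k with
    | zero => rw [stieltjes, ih (by grind)]; simp
    | succ k => rw [stieltjes, ih (by grind), ih (by grind)]; simp

theorem favardPoly_natDegree_monic (n : ℕ) :
    (favardPoly c n).natDegree = n ∧ (favardPoly c n).Monic := by
  induction n using Nat.strong_induction_on with
  | _ n ih =>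
    match n with
    | 0 => exact ⟨by simp [favardPoly], by simp [favardPoly]⟩
    | 1 => exact ⟨by simp [favardPoly], by simp [favardPoly, monic_X]⟩
    | n + 2 =>
      obtain ⟨h1, m1⟩ := ih (n + 1) (by omega)
      obtain ⟨h0, m0⟩ := ih n (by omega)
      have hX : (X * favardPoly c (n + 1)).Monic := monic_X.mul m1
      have hXd : (X * favardPoly c (n + 1)).natDegree = n + 2 := by
        rw [natDegree_X_mul m1.ne_zero, h1]
      have hlt : (C (c n) * favardPoly c n).degree < (X * favardPoly c (n + 1)).degree := by
        rw [degree_eq_natDegree hX.ne_zero, hXd]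
        refine (degree_le_natDegree.trans
          (Nat.cast_le.2 ((natDegree_C_mul_le _ _).trans h0.le))).trans_lt ?_
        exact_mod_cast (by omega : n < n + 2)
      rw [favardPoly]
      refine ⟨?_, hX.sub_of_left hlt⟩
      rw [natDegree_sub_eq_left_of_natDegree_lt, hXd]
      rw [hXd]
      exact ((natDegree_C_mul_le _ _).trans h0.le).trans_lt (by omega)

theorem favardPoly_coeff_self (n : ℕ) : (favardPoly c n).coeff n = 1 := by
  obtain ⟨h, m⟩ := favardPoly_natDegree_monic c n
  simpa [Monic, leadingCoeff, h] using m

theorem favardPoly_coeff_eq_zero_of_lt {n i : ℕ} (h : n < i) : (favardPoly c n).coeff i = 0 :=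
  coeff_eq_zero_of_natDegree_lt (by rwa [(favardPoly_natDegree_monic c n).1])

theorem favardPoly_coeff_eq_zero_of_odd {n i : ℕ} (h : Odd (n + i)) :
    (favardPoly c n).coeff i = 0 := by
  induction n using Nat.strong_induction_on generalizing i with
  | _ n ih =>
    match n with
    | 0 =>
      have : i ≠ 0 := by rintro rfl; simp at h
      simp [favardPoly, coeff_one, this]
    | 1 =>
      have : i ≠ 1 := by rintro rfl; revert h; decide
      simp [favardPoly, coeff_X, this.symm]
    | n + 2 =>
      cases i with
      | zero => simp [favardPoly, ih n (by omega) (i := 0) (by grind)]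
      | succ i =>
        simp [favardPoly, coeff_X_mul, ih n (by omega) (i := i + 1) (by grind),
          ih (n + 1) (by omega) (i := i) (by grind)]

/-- The case `k = 0` shows that the values on the `P_n` force the moments, hence uniqueness. The
product of the `c i` stands for `Λ(P_k²)`; nothing is divided by it, so vanishing `c i` are allowed.
-/
theorem functional_X_pow_mul_favardPoly {Λ : K[X] →ₗ[K] K}
    (h : ∀ n, Λ (favardPoly c n) = if n = 0 then 1 else 0) (n k : ℕ) :
    Λ (X ^ n * favardPoly c k) = (∏ i ∈ Finset.range k, c i) * stieltjes c n k := by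
  induction n generalizing k with
  | zero => cases k with
    | zero => simp [h, stieltjes]
    | succ k => simp [h, stieltjes]
  | succ n ih => cases k with
    | zero =>
      have : X ^ (n + 1) * favardPoly c 0 = X ^ n * favardPoly c 1 := by
        simp only [favardPoly]; ring
      rw [this, ih, stieltjes]; simp
    | succ k =>
      have : X ^ (n + 1) * favardPoly c (k + 1) =
          X ^ n * favardPoly c (k + 2) + c k • (X ^ n * favardPoly c k) := by
        rw [favardPoly, smul_eq_C_mul]; ring
      rw [this, map_add, map_smul, ih, ih, stieltjes, Finset.prod_range_succ,
        Finset.prod_range_succ, smul_eq_mul]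
      ring

/-- The converse direction, giving existence: here only the moments are known, so the induction runs
on `k` through the recurrence for `P_k`. -/
theorem momentFunctional_stieltjes_X_pow_mul_favardPoly (n k : ℕ) :
    momentFunctional (fun n => stieltjes c n 0) (X ^ n * favardPoly c k) =
      (∏ i ∈ Finset.range k, c i) * stieltjes c n k := by
  induction k using Nat.strong_induction_on generalizing n with
  | _ k ih =>
    match k with
    | 0 => simp [favardPoly, momentFunctional_X_pow]
    | 1 =>
      have : X ^ n * favardPoly c 1 = X ^ (n + 1) := by rw [favardPoly]; ring
      rw [this, momentFunctional_X_pow, stieltjes]; simp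
    | k + 2 =>
      have : X ^ n * favardPoly c (k + 2) =
          X ^ (n + 1) * favardPoly c (k + 1) - c k • (X ^ n * favardPoly c k) := by
        rw [favardPoly, smul_eq_C_mul]; ring
      rw [this, map_sub, map_smul, ih _ (by omega), ih _ (by omega), stieltjes,
        Finset.prod_range_succ _ (k + 1), Finset.prod_range_succ, smul_eq_mul]
      ring

theorem momentFunctional_stieltjes_favardPoly (n : ℕ) :
    momentFunctional (fun n => stieltjes c n 0) (favardPoly c n) = if n = 0 then 1 else 0 := by
  have := momentFunctional_stieltjes_X_pow_mul_favardPoly c 0 n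
  rw [pow_zero, one_mul] at this
  rw [this]
  cases n <;> simp [stieltjes]

theorem functional_favardPoly_unique {Λ : K[X] →ₗ[K] K}
    (h : ∀ n, Λ (favardPoly c n) = if n = 0 then 1 else 0) :
    Λ = momentFunctional (fun n => stieltjes c n 0) := by
  refine (Polynomial.basisMonomials K).ext fun n => ?_
  change Λ (monomial n 1) = momentFunctional _ (monomial n 1)
  rw [monomial_one_right_eq_X_pow, momentFunctional_X_pow]
  simpa [favardPoly] using functional_X_pow_mul_favardPoly c h n 0

theorem functional_mul_favardPoly_of_natDegree_lt {Λ : K[X] →ₗ[K] K}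
    (h : ∀ n, Λ (favardPoly c n) = if n = 0 then 1 else 0) {p : K[X]} {m : ℕ}
    (hp : p.natDegree < m) : Λ (p * favardPoly c m) = 0 := by
  rw [p.as_sum_range_C_mul_X_pow, Finset.sum_mul, map_sum]
  refine Finset.sum_eq_zero fun i hi => ?_
  rw [mul_assoc, ← smul_eq_C_mul, map_smul, functional_X_pow_mul_favardPoly c h,
    stieltjes_eq_zero_of_lt c (by grind)]
  simp

theorem functional_favardPoly_mul_favardPoly {Λ : K[X] →ₗ[K] K}
    (h : ∀ n, Λ (favardPoly c n) = if n = 0 then 1 else 0) {n m : ℕ} (hnm : n ≠ m) :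
    Λ (favardPoly c n * favardPoly c m) = 0 := by
  rcases lt_or_gt_of_ne hnm with hlt | hlt
  · exact functional_mul_favardPoly_of_natDegree_lt c h
      (by rwa [(favardPoly_natDegree_monic c n).1])
  · rw [mul_comm]
    exact functional_mul_favardPoly_of_natDegree_lt c h
      (by rwa [(favardPoly_natDegree_monic c m).1])

end Favard

/-! ### Hankel determinants of convolution polynomials via associated polynomials. -/

/-- The moments of the second-kind functional `p ↦ Λ ((p(y) - p(x)) / (y - x))`, where `Λ` has
moments `μ`. -/
def quotientMoment {K : Type*} [Field K] (μ : ℕ → K) (x : K) : ℕ → K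
  | 0 => 0
  | n + 1 => x * quotientMoment μ x n + μ n

/-- The values at `x` of the associated (numerator) polynomials of `favardPoly c`. -/
def favardNumerator {K : Type*} [Field K] (c : ℕ → K) (x : K) : ℕ → K
  | 0 => 0
  | 1 => 1
  | n + 2 => x * favardNumerator c x (n + 1) - c n * favardNumerator c x n

section Hankel

variable {K : Type*} [Field K] (c : ℕ → K)

theorem convPoly_succ (a : ℕ → K) (n : ℕ) (x : K) :
    convPoly a (n + 1) x = a (n + 1) + x * convPoly a n x := by
  rw [convPoly, Finset.sum_range_succ', convPoly, Finset.mul_sum, add_comm]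
  congr 1
  · simp
  · refine Finset.sum_congr rfl fun k _ => ?_
    rw [Nat.add_sub_add_right]; ring

theorem quotientMoment_odd {μ : ℕ → K} (hμ : ∀ n, μ (2 * n + 1) = 0) (x : K) (j : ℕ) :
    quotientMoment μ x (2 * j + 1) = convPoly (fun n => μ (2 * n)) j (x ^ 2) := by
  induction j with
  | zero => simp [quotientMoment, convPoly]
  | succ j ih =>
    have h : quotientMoment μ x (2 * (j + 1) + 1) =
        x * (x * quotientMoment μ x (2 * j + 1) + μ (2 * j + 1)) + μ (2 * (j + 1)) := rfl
    rw [h, ih, hμ, convPoly_succ]; ring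

/-- This is `(y p(y) - x p(x)) / (y - x) = x (p(y) - p(x)) / (y - x) + p(y)`. For `p = P_{n+1}` the
last term has moment zero, so the images of the `P_n` satisfy the same recurrence. -/
theorem momentFunctional_quotientMoment_X_mul (μ : ℕ → K) (x : K) (p : K[X]) :
    momentFunctional (quotientMoment μ x) (X * p) =
      x * momentFunctional (quotientMoment μ x) p + momentFunctional μ p := by
  rw [p.as_sum_range_C_mul_X_pow]
  simp only [Finset.mul_sum, map_sum, ← Finset.sum_add_distrib]
  refine Finset.sum_congr rfl fun i _ => ?_
  have : X * (C (p.coeff i) * X ^ i) = p.coeff i • X ^ (i + 1) := by rw [smul_eq_C_mul]; ring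
  rw [this, ← smul_eq_C_mul, map_smul, map_smul, map_smul, momentFunctional_X_pow,
    momentFunctional_X_pow, momentFunctional_X_pow, quotientMoment]
  simp only [smul_eq_mul]; ring

theorem momentFunctional_quotientMoment_favardPoly (x : K) (n : ℕ) :
    momentFunctional (quotientMoment (fun n => stieltjes c n 0) x) (favardPoly c n) =
      favardNumerator c x n := by
  induction n using Nat.strong_induction_on with
  | _ n ih =>
    match n with
    | 0 => simpa [favardPoly, favardNumerator, quotientMoment] using
        momentFunctional_X_pow (quotientMoment (fun n => stieltjes c n 0) x) 0
    | 1 => simpa [favardPoly, favardNumerator, quotientMoment, stieltjes] using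
        momentFunctional_X_pow (quotientMoment (fun n => stieltjes c n 0) x) 1
    | n + 2 =>
      rw [favardPoly, ← smul_eq_C_mul, map_sub, map_smul, momentFunctional_quotientMoment_X_mul,
        ih _ (by omega), ih _ (by omega), momentFunctional_stieltjes_favardPoly, favardNumerator]
      simp

/-- The free bound `N` gives all columns of the matrix product below a common summation range. -/
theorem favardPoly_odd_eq_sum {k N : ℕ} (h : k < N) :
    favardPoly c (2 * k + 1) = ∑ j ∈ Finset.range N,
      (favardPoly c (2 * k + 1)).coeff (2 * j + 1) • X ^ (2 * j + 1) := by
  ext i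
  simp only [finsetSum_coeff, coeff_smul, coeff_X_pow, smul_eq_mul, mul_ite, mul_one, mul_zero]
  rcases Nat.even_or_odd' i with ⟨j, rfl | rfl⟩
  · rw [favardPoly_coeff_eq_zero_of_odd c (by grind), Finset.sum_eq_zero]
    intro l _
    rw [if_neg (by omega)]
  · by_cases hj : j < N
    · rw [Finset.sum_eq_single j]
      · simp
      · intro l _ hl
        rw [if_neg (by omega)]
      · intro hj'
        exact absurd (Finset.mem_range.2 hj) hj'
    · rw [favardPoly_coeff_eq_zero_of_lt c (by omega), Finset.sum_eq_zero]
      intro l hl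
      rw [if_neg (by grind)]

/-- The Hankel determinant of the convolution polynomials of the even moments is, up to a
factor independent of `x`, an associated polynomial. -/
theorem hankelDet_stieltjes (n : ℕ) (x : K) :
    hankelDet (fun n => stieltjes c (2 * n) 0) n (x ^ 2) =
      (-1) ^ n * favardNumerator c x (2 * n + 1) *
        ∏ k : Fin n, ∏ i ∈ Finset.range (2 * (k : ℕ) + 1), c i := by
  set a : ℕ → K := fun n => stieltjes c (2 * n) 0 with ha
  have hμ : ∀ n, (fun n => stieltjes c n 0) (2 * n + 1) = 0 := fun n =>
    stieltjes_eq_zero_of_odd c (by grind)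
  let B : Matrix (Fin (n + 1)) (Fin (n + 1)) K := Matrix.of fun i j =>
    if i = 0 then convPoly a j (x ^ 2) else a (i + j)
  let U : Matrix (Fin (n + 1)) (Fin (n + 1)) K := Matrix.of fun j k =>
    (favardPoly c (2 * (k : ℕ) + 1)).coeff (2 * (j : ℕ) + 1)
  -- Subtract `x²` times the preceding row: `r(m+1) - x² r(m) = a(m+1)`.
  have hB : hankelDet a n (x ^ 2) = B.det := by
    refine Matrix.det_eq_of_forall_row_eq_smul_add_pred (fun _ => x ^ 2) (fun j => ?_)
      fun i j => ?_
    · simp [B]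
    · simp only [B, Matrix.of_apply, Fin.val_succ, Fin.val_castSucc, Fin.succ_ne_zero, if_false]
      rw [show (i : ℕ) + 1 + (j : ℕ) = i + j + 1 by ring, convPoly_succ]
  have hU : U.det = 1 := by
    rw [Matrix.det_of_isUpperTriangular]
    · exact Finset.prod_eq_one fun i _ => favardPoly_coeff_self c _
    · intro i j hij
      exact favardPoly_coeff_eq_zero_of_lt c (by simp at hij; omega)
  have hzero : ∀ k : Fin (n + 1), (B * U) 0 k = favardNumerator c x (2 * (k : ℕ) + 1) := by
    intro k
    rw [← momentFunctional_quotientMoment_favardPoly, favardPoly_odd_eq_sum c k.2, map_sum,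
      Matrix.mul_apply, Finset.sum_range]
    refine Finset.sum_congr rfl fun j _ => ?_
    rw [map_smul, momentFunctional_X_pow, quotientMoment_odd hμ, smul_eq_mul, mul_comm]
    simp [B, U, ha]
  -- The entry is `Λ(x^(2i+1) P_{2k+1})`, since `a(i+1+j)` is the moment of order `(2i+1) + (2j+1)`;
  -- it vanishes for `i < k`.
  have hsucc : ∀ (i : Fin n) (k : Fin (n + 1)), (B * U) i.succ k =
      (∏ l ∈ Finset.range (2 * (k : ℕ) + 1), c l) *
        stieltjes c (2 * (i : ℕ) + 1) (2 * (k : ℕ) + 1) := by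
    intro i k
    rw [← momentFunctional_stieltjes_X_pow_mul_favardPoly, favardPoly_odd_eq_sum c k.2,
      Finset.mul_sum, map_sum, Matrix.mul_apply, Finset.sum_range]
    refine Finset.sum_congr rfl fun j _ => ?_
    rw [mul_smul_comm, map_smul, ← pow_add, momentFunctional_X_pow, smul_eq_mul, mul_comm]
    simp only [B, U, ha, Matrix.of_apply, Fin.succ_ne_zero, if_false, Fin.val_succ]
    congr 2
    ring
  have hdet : ((B * U).submatrix (Fin.succAbove 0) (Fin.last n).succAbove).det =
      ∏ k : Fin n, ∏ i ∈ Finset.range (2 * (k : ℕ) + 1), c i := by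
    rw [Matrix.det_of_isLowerTriangular]
    · refine Finset.prod_congr rfl fun k _ => ?_
      simp [hsucc, stieltjes_self]
    · intro i k hik
      have : i < k := by simpa using hik
      simp only [Matrix.submatrix_apply, Fin.zero_succAbove, Fin.succAbove_last, hsucc,
        Fin.val_castSucc]
      rw [stieltjes_eq_zero_of_lt c (by omega), mul_zero]
  have hBU : B.det = (B * U).det := by rw [Matrix.det_mul, hU, mul_one]
  -- In the last column only the top entry survives; its cofactor contributes the sign `(-1)^n`.
  rw [hB, hBU, Matrix.det_succ_column _ (Fin.last n),
    Fin.sum_univ_succ, Finset.sum_eq_zero, hdet, hzero]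
  · simp
  · intro i _
    rw [hsucc, stieltjes_eq_zero_of_lt c (by simp)]
    simp

theorem favardNumerator_zero_odd (n : ℕ) :
    favardNumerator c 0 (2 * n + 1) = (-1) ^ n * ∏ k ∈ Finset.range n, c (2 * k + 1) := by
  induction n with
  | zero => simp [favardNumerator]
  | succ n ih =>
    rw [show 2 * (n + 1) + 1 = 2 * n + 1 + 2 by ring, favardNumerator, ih,
      Finset.prod_range_succ]
    ring

theorem hankelDet_stieltjes_zero_ne_zero (hc : ∀ n, c n ≠ 0) (n : ℕ) :
    hankelDet (fun n => stieltjes c (2 * n) 0) n 0 ≠ 0 := by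
  have h := hankelDet_stieltjes c n 0
  rw [zero_pow two_ne_zero] at h
  rw [h, favardNumerator_zero_odd]
  refine mul_ne_zero (mul_ne_zero (pow_ne_zero _ (by simp)) (mul_ne_zero (pow_ne_zero _ (by simp))
    (Finset.prod_ne_zero_iff.2 fun k _ => hc _))) (Finset.prod_ne_zero_iff.2 fun k _ =>
      Finset.prod_ne_zero_iff.2 fun i _ => hc _)

theorem hankelDet_stieltjes_div (hc : ∀ n, c n ≠ 0) (n : ℕ) (x : K) :
    hankelDet (fun n => stieltjes c (2 * n) 0) n (x ^ 2) /
        hankelDet (fun n => stieltjes c (2 * n) 0) n 0 =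
      (-1) ^ n / (∏ k ∈ Finset.range n, c (2 * k + 1)) * favardNumerator c x (2 * n + 1) := by
  have h := hankelDet_stieltjes c n 0
  rw [zero_pow two_ne_zero] at h
  rw [div_eq_iff (hankelDet_stieltjes_zero_ne_zero c hc n), h, hankelDet_stieltjes,
    favardNumerator_zero_odd]
  have h1 : ∏ k ∈ Finset.range n, c (2 * k + 1) ≠ 0 := Finset.prod_ne_zero_iff.2 fun k _ => hc _
  have h2 : ((-1 : K) ^ n) * (-1) ^ n = 1 := by rw [← mul_pow]; simp
  field_simp
  linear_combination -(favardNumerator c x (2 * n + 1) *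
    ∏ k : Fin n, ∏ i ∈ Finset.range (2 * (k : ℕ) + 1), c i) * h2

end Hankel

/-! ### Recurrence coefficients and Gaussian binomial identities. -/

/-- The product `∏_{j=1}^n (1 + q^j)`. -/
def qPlusProd {K : Type*} [Field K] (q : K) (n : ℕ) : K := ∏ j ∈ Finset.Icc 1 n, (1 + q ^ j)

/-- The recurrence coefficients of the polynomials `p_n`. -/
def qLucasCoeff {K : Type*} [Field K] (q : K) : ℕ → K
  | 0 => 1 / (1 + q)
  | n + 1 => q ^ (n + 1) / ((1 + q ^ (n + 1)) * (1 + q ^ (n + 2)))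

section QBinomial

variable {K : Type*} [Field K] (q : K)

theorem qBinomial_eq_zero_of_lt {n k : ℕ} (h : n < k) : qBinomial q n k = 0 := by
  induction n generalizing k with
  | zero => obtain ⟨k, rfl⟩ := Nat.exists_eq_succ_of_ne_zero h.ne'; rfl
  | succ n ih =>
    obtain ⟨k, rfl⟩ := Nat.exists_eq_succ_of_ne_zero (Nat.ne_zero_of_lt h)
    rw [qBinomial, ih (by omega), ih (by omega)]; simp

theorem qBinomial_zero_right (n : ℕ) : qBinomial q n 0 = 1 := by
  cases n <;> rfl

theorem qBinomial_self (n : ℕ) : qBinomial q n n = 1 := by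
  induction n with
  | zero => rfl
  | succ n ih => rw [qBinomial, ih, qBinomial_eq_zero_of_lt q (by omega)]; simp

theorem qBinomial_pascal (a b : ℕ) : qBinomial q (a + b + 2) (a + 1) =
    qBinomial q (a + b + 1) a + q ^ (a + 1) * qBinomial q (a + b + 1) (a + 1) := rfl

theorem qBinomial_pascal' (a b : ℕ) : qBinomial q (a + b + 2) (a + 1) =
    q ^ (b + 1) * qBinomial q (a + b + 1) a + qBinomial q (a + b + 1) (a + 1) := by
  induction a generalizing b with
  | zero =>
    induction b with
    | zero => simp [qBinomial]; ring
    | succ b ih =>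
      have h1 := qBinomial_pascal q 0 (b + 1)
      have h2 := qBinomial_pascal q 0 b
      simp only [qBinomial_zero_right] at *
      rw [show 0 + (b + 1) + 1 = 0 + b + 2 by ring] at *
      linear_combination h1 - h2 + q * ih
  | succ a iha =>
    induction b with
    | zero =>
      have h1 := qBinomial_pascal q (a + 1) 0
      have h2 := qBinomial_pascal q a 0
      have h3 := iha 0
      have h4 := qBinomial_self q (a + 2)
      have h5 := qBinomial_self q (a + 1)
      simp only [add_zero, zero_add, pow_one] at *
      rw [show a + 1 + 1 = a + 2 by ring] at *
      rw [h4] at h1 ⊢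
      rw [h5] at h2 h3
      linear_combination h1 + h3 - q * h2
    | succ b ihb =>
      have h1 := qBinomial_pascal q (a + 1) (b + 1)
      have h2 := qBinomial_pascal q a (b + 1)
      have h3 := qBinomial_pascal q (a + 1) b
      have h4 := iha (b + 1)
      rw [show a + 1 + (b + 1) + 1 = a + b + 3 by ring] at *
      rw [show a + 1 + b + 2 = a + b + 3 by ring] at *
      rw [show a + (b + 1) + 2 = a + b + 3 by ring] at *
      rw [show a + (b + 1) + 1 = a + b + 2 by ring] at *
      rw [show a + 1 + b + 1 = a + b + 2 by ring] at *
      linear_combination h1 + h4 + q ^ (a + 2) * ihb - q ^ (b + 2) * h2 - h3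

theorem qBinomial_symm (a b : ℕ) : qBinomial q (a + b) a = qBinomial q (a + b) b := by
  induction a generalizing b with
  | zero => simp [qBinomial_self, qBinomial_zero_right]
  | succ a iha =>
    induction b with
    | zero => simp [qBinomial_self, qBinomial_zero_right]
    | succ b ihb =>
      have h1 := qBinomial_pascal q a b
      have h2 := qBinomial_pascal' q b a
      have h3 := iha (b + 1)
      rw [show a + 1 + (b + 1) = a + b + 2 by ring, h1]
      rw [show b + a + 2 = a + b + 2 by ring, show b + a + 1 = a + b + 1 by ring] at h2
      rw [show a + 1 + b = a + b + 1 by ring] at ihb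
      rw [show a + (b + 1) = a + b + 1 by ring] at h3
      rw [h2, ihb, h3]; ring

theorem qNumber_succ (n : ℕ) : qNumber q (n + 1) = qNumber q n + q ^ n :=
  Finset.sum_range_succ _ _

theorem qNumber_zero : qNumber q 0 = 0 := rfl

theorem qNumber_add (m n : ℕ) : qNumber q (m + n) = qNumber q m + q ^ m * qNumber q n := by
  induction n with
  | zero => simp [qNumber_zero]
  | succ n ih => rw [← add_assoc, qNumber_succ, ih, qNumber_succ]; ring

/-- Replaces `[n] = (q^n - 1)/(q - 1)` without division, so that `q = 1` is covered. -/
theorem pow_eq_one_add_mul_qNumber (n : ℕ) : q ^ n = 1 + (q - 1) * qNumber q n := by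
  induction n with
  | zero => simp [qNumber_zero]
  | succ n ih => rw [qNumber_succ]; linear_combination ih

theorem qNumber_mul_qBinomial_succ (a b : ℕ) :
    qNumber q (a + 1) * qBinomial q (a + b + 1) (a + 1) =
      qNumber q (a + b + 1) * qBinomial q (a + b) a := by
  induction h : a + b using Nat.strong_induction_on generalizing a b with
  | _ s ih =>
    subst h
    cases b with
    | zero => simp [qBinomial_self]
    | succ b =>
      have h1 := qBinomial_pascal q a b
      have h2 := ih (a + b) (by omega) a b rfl
      have h3 := ih (a + b) (by omega) b a (by ring)
      have h4 := qBinomial_symm q a (b + 1)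
      have h5 := qBinomial_symm q a b
      have h6 := qNumber_add q (a + 1) (b + 1)
      rw [show a + 1 + (b + 1) = a + b + 2 by ring] at h6
      rw [show a + (b + 1) = a + b + 1 by ring] at h4 ⊢
      rw [show a + b + 1 + 1 = a + b + 2 by ring, h6]
      linear_combination qNumber q (a + 1) * h1 + q ^ (a + 1) * h2 - q ^ (a + 1) * h3
        - q ^ (a + 1) * qNumber q (b + 1) * h4 + q ^ (a + 1) * qNumber q (a + b + 1) * h5

theorem qNumber_mul_qBinomial_succ_right (a b : ℕ) :
    qNumber q (b + 1) * qBinomial q (a + b + 1) a =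
      qNumber q (a + b + 1) * qBinomial q (a + b) a := by
  have h1 := qNumber_mul_qBinomial_succ q b a
  have h2 := qBinomial_symm q a (b + 1)
  rw [show b + a = a + b by ring, ← qBinomial_symm q a b] at h1
  rw [← add_assoc] at h2
  rw [h2, h1]

end QBinomial

/-! ### Moments, associated polynomials and coefficients in the q-Lucas case. -/

section QLucas

variable {K : Type*} [Field K] (q : K)

theorem qPlusProd_zero : qPlusProd q 0 = 1 := by simp [qPlusProd]

theorem qPlusProd_succ (n : ℕ) : qPlusProd q (n + 1) = qPlusProd q n * (1 + q ^ (n + 1)) :=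
  Finset.prod_Icc_succ_top (by omega) _

theorem qPlusProd_ne_zero (hq1 : ∀ j : ℕ, 1 ≤ j → 1 + q ^ j ≠ 0) (n : ℕ) :
    qPlusProd q n ≠ 0 :=
  Finset.prod_ne_zero_iff.2 fun j hj => hq1 j (Finset.mem_Icc.1 hj).1

theorem qPlusProd_mul_prod_Ico {m n : ℕ} (h : m ≤ n) :
    qPlusProd q m * ∏ j ∈ Finset.Ico (m + 1) (n + 1), (1 + q ^ j) = qPlusProd q n := by
  induction n, h using Nat.le_induction with
  | base => simp
  | succ n h ih =>
    rw [Finset.prod_Ico_succ_top (by omega), ← mul_assoc, ih, qPlusProd_succ]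

theorem qLucasCoeff_ne_zero (hq : q ≠ 0) (hq1 : ∀ j : ℕ, 1 ≤ j → 1 + q ^ j ≠ 0) (n : ℕ) :
    qLucasCoeff q n ≠ 0 := by
  cases n with
  | zero => exact div_ne_zero one_ne_zero (by simpa using hq1 1 le_rfl)
  | succ n =>
    exact div_ne_zero (pow_ne_zero _ hq) (mul_ne_zero (hq1 _ (by omega)) (hq1 _ (by omega)))

theorem stieltjes_qLucasCoeff (hq1 : ∀ j : ℕ, 1 ≤ j → 1 + q ^ j ≠ 0) (j k : ℕ) :
    stieltjes (qLucasCoeff q) (2 * j + k) k =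
      qBinomial q (2 * j + k) j * qPlusProd q k / (qPlusProd q j * qPlusProd q (j + k)) := by
  induction h : 2 * j + k generalizing j k with
  | zero =>
    obtain rfl : j = 0 := by omega
    obtain rfl : k = 0 := by omega
    simp [stieltjes, qBinomial, qPlusProd_zero]
  | succ n ih =>
    have hA := qPlusProd_ne_zero q hq1
    cases j with
    | zero =>
      obtain rfl : k = n + 1 := by omega
      rw [stieltjes_self, qBinomial_zero_right, qPlusProd_zero, zero_add]
      field_simp [hA (n + 1)]
    | succ j =>
      cases k with
      | zero =>
        obtain rfl : n = 2 * j + 1 := by omega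
        have h1 := qBinomial_pascal q j j
        have h2 := qBinomial_symm q j (j + 1)
        rw [show j + j + 2 = 2 * j + 1 + 1 by ring, show j + j + 1 = 2 * j + 1 by ring] at h1
        rw [show j + (j + 1) = 2 * j + 1 by ring] at h2
        rw [stieltjes, ih j 1 (by ring), h1, ← h2, qLucasCoeff, add_zero, qPlusProd_succ q j,
          qPlusProd_succ q 0, qPlusProd_zero]
        have h3 := hq1 1 le_rfl
        have h4 := hq1 (j + 1) (by omega)
        have h5 := hA j
        simp only [zero_add, pow_one] at *
        field_simp
      | succ k =>
        obtain rfl : n = 2 * j + k + 2 := by omega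
        have h1 := qBinomial_pascal q j (j + k + 1)
        have h2 := qBinomial_pascal' q j (j + k + 1)
        rw [show j + (j + k + 1) + 2 = 2 * j + k + 2 + 1 by ring,
          show j + (j + k + 1) + 1 = 2 * j + k + 2 by ring] at h1 h2
        rw [stieltjes, ih (j + 1) k (by ring), ih j (k + 2) (by ring), qLucasCoeff,
          show j + 1 + (k + 1) = j + k + 1 + 1 by ring, show j + 1 + k = j + k + 1 by ring,
          show j + (k + 2) = j + k + 1 + 1 by ring, qPlusProd_succ q j,
          qPlusProd_succ q (j + k + 1), qPlusProd_succ q (k + 1), qPlusProd_succ q k]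
        have h3 := hq1 (k + 1) (by omega)
        have h4 := hq1 (j + 1) (by omega)
        have h5 := hq1 (k + 1 + 1) (by omega)
        have h6 := hq1 (j + k + 1 + 1) (by omega)
        have h7 := hA j
        have h8 := hA k
        have h9 := hA (j + k + 1)
        rw [show k + 2 = k + 1 + 1 by ring]
        field_simp
        -- Adding `q^(k+1)` times one Pascal rule to the other makes both coefficients factor:
        -- `q^(k+1) (1 + q^(j+1))` and `1 + q^(j+k+2)`.
        linear_combination -(q ^ (k + 1)) * h1 - h2

theorem stieltjes_qLucasCoeff_even (hq1 : ∀ j : ℕ, 1 ≤ j → 1 + q ^ j ≠ 0) :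
    (fun n => stieltjes (qLucasCoeff q) (2 * n) 0) = qCentral q := by
  funext n
  have := stieltjes_qLucasCoeff q hq1 n 0
  rw [add_zero, add_zero, qPlusProd_zero, mul_one] at this
  rw [this, qCentral, Finset.prod_pow, sq]
  rfl

theorem prod_qLucasCoeff_odd (n : ℕ) : ∏ k ∈ Finset.range n, qLucasCoeff q (2 * k + 1) =
    q ^ (n ^ 2) / qPlusProd q (2 * n) := by
  induction n with
  | zero => simp [qPlusProd_zero]
  | succ n ih =>
    rw [Finset.prod_range_succ, ih, qLucasCoeff, show 2 * (n + 1) = 2 * n + 1 + 1 by ring,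
      qPlusProd_succ, qPlusProd_succ, div_mul_div_comm, ← pow_add, mul_assoc]
    congr 2
    ring

theorem favardNumerator_qLucasCoeff (x : K) (n : ℕ) :
    favardNumerator (qLucasCoeff q) x n = qbFib x (-1) (-q) q n := by
  induction n using Nat.strong_induction_on with
  | _ n ih =>
    match n with
    | 0 => rfl
    | 1 => rfl
    -- The exceptional coefficient `c_0` only ever multiplies the zeroth term, which is `0`, so it
    -- plays no role here.
    | 2 => simp [favardNumerator, qbFib]
    | n + 3 =>
      rw [favardNumerator, qbFib, ih _ (by omega), ih _ (by omega), qLucasCoeff]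
      have : q ^ (((n + 1 : ℕ) : ℤ) - 1) = q ^ n := by
        rw [Nat.cast_succ, add_sub_cancel_right, zpow_natCast]
      rw [this, pow_succ q n]
      ring

/-- What remains of the recurrence for the coefficients of `P_n` once common factors are cancelled.
-/
theorem qNumber_three_term (k m : ℕ) :
    qNumber q (2 * k + m + 2) * (1 + q ^ (k + m)) * qNumber q (k + m) =
      qNumber q (2 * k + m + 1) * qNumber q m * (1 + q ^ (2 * k + m + 1)) +
        q ^ m * (1 + q ^ (k + 1)) * qNumber q (2 * k + m) * qNumber q (k + 1) := by
  simp only [qNumber_succ, two_mul, qNumber_add, pow_add, pow_eq_one_add_mul_qNumber q k,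
    pow_eq_one_add_mul_qNumber q m]
  ring

theorem coeff_favardPoly_succ_succ (c : ℕ → K) (n m : ℕ) :
    (favardPoly c (n + 2)).coeff (m + 1) =
      (favardPoly c (n + 1)).coeff m - c n * (favardPoly c n).coeff (m + 1) := by
  rw [favardPoly, coeff_sub, coeff_X_mul, coeff_C_mul]

theorem coeff_zero_favardPoly_succ_succ (c : ℕ → K) (n : ℕ) :
    (favardPoly c (n + 2)).coeff 0 = -(c n * (favardPoly c n).coeff 0) := by
  rw [favardPoly, coeff_sub, coeff_X_mul_zero, coeff_C_mul, zero_sub]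

/-- The index `k + 1` is the summation index of `qLucas`. Writing the degree as `2k+m+2` avoids
truncated subtraction and confines `c_0` to the case `k = m = 0`. -/
theorem coeff_favardPoly_qLucasCoeff (hq1 : ∀ j : ℕ, 1 ≤ j → 1 + q ^ j ≠ 0)
    (hn : ∀ j : ℕ, 1 ≤ j → qNumber q j ≠ 0) (k m : ℕ) :
    (favardPoly (qLucasCoeff q) (2 * k + m + 2)).coeff m =
      (-1) ^ (k + 1) * q ^ (k * (k + 1)) * qNumber q (2 * k + m + 2) / qNumber q (k + 1) *
        qBinomial q (k + m) k * qPlusProd q (k + m) /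
        (qPlusProd q (k + 1) * qPlusProd q (2 * k + m + 1)) := by
  have hA := qPlusProd_ne_zero q hq1
  have h1 : 1 + q ≠ 0 := by simpa using hq1 1 le_rfl
  induction k generalizing m with
  | zero =>
    simp only [mul_zero, zero_add, pow_one, pow_zero, qBinomial_zero_right, mul_one]
    induction m with
    | zero =>
      rw [coeff_zero_favardPoly_succ_succ, favardPoly_coeff_self, qLucasCoeff]
      simp only [qNumber_succ, qNumber_zero, qPlusProd_succ, qPlusProd_zero, zero_add, pow_zero,
        pow_one]
      field_simp
    | succ m ih =>
      rw [coeff_favardPoly_succ_succ, show m + 1 + 1 = m + 2 by ring, ih, favardPoly_coeff_self,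
        qLucasCoeff]
      have h2 := hq1 (m + 1) (by omega)
      have h3 := hq1 (m + 2) (by omega)
      have h4 := hA m
      simp only [qNumber_succ, qNumber_zero, qPlusProd_succ, qPlusProd_zero, zero_add, pow_zero]
      rw [show m + 1 + 1 = m + 2 by ring]
      field_simp
      simp only [pow_succ, pow_eq_one_add_mul_qNumber q m]
      ring
  | succ k ihk =>
    have hqp : q ^ ((k + 1) * (k + 1 + 1)) = q ^ (k * (k + 1)) * (q ^ k * q ^ k * q ^ 2) := by
      rw [← pow_add, ← pow_add, ← pow_add]; congr 1; ring
    have h2 := hn (k + 1) (by omega)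
    have h3 := hn (k + 2) (by omega)
    induction m with
    | zero =>
      rw [coeff_zero_favardPoly_succ_succ]
      have := ihk 0
      simp only [add_zero, qBinomial_self, mul_one] at this ⊢
      -- At `m = 0` the denominators `[k+1]`, `[k+2]` cancel through `[2j] = [j] (1 + q^j)`.
      have h4 := qNumber_add q (k + 1) (k + 1)
      have h5 := qNumber_add q (k + 2) (k + 2)
      rw [show k + 1 + (k + 1) = 2 * k + 2 by ring] at h4
      rw [show k + 2 + (k + 2) = 2 * k + 2 + 2 by ring] at h5
      have h6 := hA (k + 1)
      have h7 := hA (2 * k + 1)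
      have h8 := hA k
      have h9 := hq1 (k + 1) (by omega)
      have h10 := hq1 (k + 2) (by omega)
      have h11 := hq1 (2 * k + 2) (by omega)
      have h12 := hq1 (2 * k + 3) (by omega)
      rw [show 2 * (k + 1) = 2 * k + 2 by ring, this, qLucasCoeff, h4, h5,
        show 2 * k + 2 + 1 = 2 * k + 1 + 1 + 1 by ring, qPlusProd_succ q (2 * k + 1 + 1),
        qPlusProd_succ q (2 * k + 1), qPlusProd_succ q (k + 1), qPlusProd_succ q k, hqp,
        show k + 1 + 1 = k + 2 by ring, show 2 * k + 1 + 1 = 2 * k + 2 by ring,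
        show 2 * k + 2 + 1 = 2 * k + 3 by ring]
      field_simp
      ring
    | succ m ihm =>
      have h4 := qNumber_mul_qBinomial_succ q k (m + 1)
      have h5 := qNumber_mul_qBinomial_succ_right q (k + 1) m
      have h6 := qNumber_three_term q (k + 1) (m + 1)
      have h7 := hA (k + m + 1)
      have h8 := hA (2 * k + m + 2)
      have h9 := hA (k + 1)
      have h10 := hn (k + m + 2) (by omega)
      have h11 := hq1 (k + 2) (by omega)
      have h12 := hq1 (2 * k + m + 3) (by omega)
      have h13 := hq1 (2 * k + m + 4) (by omega)
      have h14 := hq1 (k + m + 2) (by omega)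
      have e1 : qBinomial q (k + m + 1) k =
          qNumber q (k + 1) * qBinomial q (k + m + 2) (k + 1) / qNumber q (k + m + 2) := by
        rw [eq_div_iff h10, mul_comm]; exact h4.symm
      have e2 : qBinomial q (k + m + 1) (k + 1) =
          qNumber q (m + 1) * qBinomial q (k + m + 2) (k + 1) / qNumber q (k + m + 2) := by
        rw [eq_div_iff h10, mul_comm, show k + m + 2 = k + 1 + m + 1 by ring,
          show k + m + 1 = k + 1 + m by ring]
        exact h5.symm
      rw [coeff_favardPoly_succ_succ, show 2 * (k + 1) + (m + 1) + 1 = 2 * (k + 1) + m + 2 by ring,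
        ihm, show 2 * (k + 1) + (m + 1) = 2 * k + (m + 1) + 2 by ring, ihk,
        show 2 * k + (m + 1) + 2 = 2 * k + m + 2 + 1 by ring, qLucasCoeff,
        show 2 * (k + 1) + m + 2 = 2 * k + m + 4 by ring,
        show 2 * k + m + 2 + 1 + 2 = 2 * k + m + 5 by ring,
        show 2 * (k + 1) + m + 1 = 2 * k + m + 2 + 1 by ring,
        show 2 * k + (m + 1) + 1 = 2 * k + m + 2 by ring,
        show k + 1 + (m + 1) = k + m + 1 + 1 by ring, show k + (m + 1) = k + m + 1 by ring,
        show k + 1 + m = k + m + 1 by ring, e1, e2, qPlusProd_succ q (2 * k + m + 2 + 1),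
        qPlusProd_succ q (2 * k + m + 2), qPlusProd_succ q (k + m + 1), qPlusProd_succ q (k + 1),
        hqp, show k + 1 + 1 = k + 2 by ring, show k + m + 1 + 1 = k + m + 2 by ring,
        show 2 * k + m + 2 + 1 = 2 * k + m + 3 by ring,
        show 2 * k + m + 2 + 2 = 2 * k + m + 4 by ring,
        show 2 * k + m + 3 + 1 = 2 * k + m + 4 by ring]
      rw [show 2 * (k + 1) + (m + 1) + 2 = 2 * k + m + 5 by ring,
        show k + 1 + (m + 1) = k + m + 2 by ring,
        show 2 * (k + 1) + (m + 1) + 1 = 2 * k + m + 4 by ring,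
        show 2 * (k + 1) + (m + 1) = 2 * k + m + 3 by ring,
        show k + 1 + 1 = k + 2 by ring] at h6
      field_simp
      linear_combination -((-1) ^ k * q ^ (k * (k + 1)) * q ^ (2 * k + 2) *
        qBinomial q (k + m + 2) (k + 1)) * h6

theorem qLucasOrtho_eq_favardPoly (hq1 : ∀ j : ℕ, 1 ≤ j → 1 + q ^ j ≠ 0)
    (hn : ∀ j : ℕ, 1 ≤ j → qNumber q j ≠ 0) (n : ℕ) :
    qLucasOrtho q n = favardPoly (qLucasCoeff q) n := by
  rw [qLucasOrtho]
  split_ifs with h0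
  · rw [h0, favardPoly]
  have key : ∀ k ∈ Finset.range (n / 2 + 1), q ^ (k ^ 2 - k) * (-1) ^ k *
      (qNumber q n / qNumber q (n - k)) * qBinomial q (n - k) k /
        ((∏ j ∈ Finset.Icc 1 k, (1 + q ^ j)) * ∏ j ∈ Finset.Ico (n - k) n, (1 + q ^ j)) =
      (favardPoly (qLucasCoeff q) n).coeff (n - 2 * k) := by
    intro k hk
    have hk' : 2 * k ≤ n := by have := Finset.mem_range.1 hk; omega
    obtain ⟨m, rfl⟩ := Nat.exists_eq_add_of_le hk'
    cases k with
    | zero =>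
      have := hn m (by omega)
      simp [favardPoly_coeff_self, qBinomial_zero_right, this]
    | succ k =>
      have h := coeff_favardPoly_qLucasCoeff q hq1 hn k m
      have hb := qNumber_mul_qBinomial_succ q k m
      have hA := qPlusProd_mul_prod_Ico q (show k + m ≤ 2 * k + m + 1 by omega)
      have hp := qPlusProd_ne_zero q hq1
      have h2 := hn (k + 1) (by omega)
      have h3 := hn (k + m + 1) (by omega)
      rw [show 2 * (k + 1) + m - 2 * (k + 1) = m by omega,
        show 2 * (k + 1) + m - (k + 1) = k + m + 1 by omega,
        show 2 * (k + 1) + m = 2 * k + m + 2 by ring, h,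
        show (k + 1) ^ 2 - (k + 1) = k * (k + 1) by
          rw [sq, ← Nat.sub_one_mul, Nat.add_sub_cancel]]
      change _ / (qPlusProd q (k + 1) * ∏ j ∈ Finset.Ico (k + m + 1) (2 * k + m + 1 + 1), _) = _
      rw [← hA]
      have h4 := hp (k + m)
      have h5 := hp (k + 1)
      have h6 : ∏ j ∈ Finset.Ico (k + m + 1) (2 * k + m + 1 + 1), (1 + q ^ j) ≠ 0 :=
        Finset.prod_ne_zero_iff.2 fun j hj => hq1 j (by have := Finset.mem_Ico.1 hj; omega)
      field_simp
      -- Absorption turns `[n-k choose k] / [n-k]` into the form with denominator `[k+1]`.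
      linear_combination q ^ (k * (k + 1)) * qNumber q (2 * k + m + 2) * hb
  rw [qLucas, if_neg h0]
  ext i
  rw [finsetSum_coeff, Finset.sum_congr rfl fun k hk => by rw [key k hk, coeff_C_mul_X_pow]]
  by_cases hi : i ≤ n ∧ Even (n + i)
  · obtain ⟨hi, he⟩ := hi
    obtain ⟨k, rfl⟩ : ∃ k, n = i + 2 * k := by
      obtain ⟨l, hl⟩ := he
      exact ⟨l - i, by omega⟩
    rw [Finset.sum_eq_single k]
    · rw [if_pos (by omega), Nat.add_sub_cancel]
    · intro l hl hlk
      have := Finset.mem_range.1 hl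
      rw [if_neg (by omega)]
    · intro h
      exact absurd (Finset.mem_range.2 (by omega)) h
  · rw [Finset.sum_eq_zero]
    · by_cases hin : i ≤ n
      · rw [favardPoly_coeff_eq_zero_of_odd]
        exact Nat.not_even_iff_odd.1 fun he => hi ⟨hin, he⟩
      · rw [favardPoly_coeff_eq_zero_of_lt _ (by omega)]
    · intro k hk
      rw [if_neg]
      rintro rfl
      have := Finset.mem_range.1 hk
      exact hi ⟨by omega, by grind⟩

end QLucas

theorem corollary5 {K : Type*} [Field K] (q : K) (hq : q ≠ 0)
    (hq1 : ∀ j : ℕ, 1 ≤ j → 1 + q ^ j ≠ 0) :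
    ((∀ j : ℕ, 1 ≤ j → qNumber q j ≠ 0) →
      (∃! Λ : K[X] →ₗ[K] K, ∀ n : ℕ, Λ (qLucasOrtho q n) = if n = 0 then 1 else 0) ∧
      ∀ Λ : K[X] →ₗ[K] K, (∀ n : ℕ, Λ (qLucasOrtho q n) = if n = 0 then 1 else 0) →
        (∀ n m : ℕ, n ≠ m → Λ (qLucasOrtho q n * qLucasOrtho q m) = 0) ∧
        ∀ n : ℕ, Λ (X ^ (2 * n)) = qCentral q n) ∧
    ∀ n : ℕ, hankelDet (qCentral q) n 0 ≠ 0 ∧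
      ∀ x : K, hankelDet (qCentral q) n (x ^ 2) / hankelDet (qCentral q) n 0 =
        (-1) ^ n / q ^ (n ^ 2) * (∏ j ∈ Finset.Icc 1 (2 * n), (1 + q ^ j)) *
          qbFib x (-1) (-q) q (2 * n + 1) := by
  have hc := qLucasCoeff_ne_zero q hq hq1
  have hmom := stieltjes_qLucasCoeff_even q hq1
  refine ⟨fun hn => ?_, fun n => ⟨?_, fun x => ?_⟩⟩
  · simp only [qLucasOrtho_eq_favardPoly q hq1 hn]
    refine ⟨⟨_, momentFunctional_stieltjes_favardPoly _, fun Λ h =>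
      functional_favardPoly_unique _ h⟩, fun Λ h => ⟨fun n m hnm =>
      functional_favardPoly_mul_favardPoly _ h hnm, fun n => ?_⟩⟩
    rw [functional_favardPoly_unique _ h, momentFunctional_X_pow]
    exact congrFun hmom n
  · rw [← hmom]
    exact hankelDet_stieltjes_zero_ne_zero _ hc n
  · rw [← hmom, hankelDet_stieltjes_div _ hc, prod_qLucasCoeff_odd,
      favardNumerator_qLucasCoeff q, div_div_eq_mul_div, mul_div_right_comm]
    rfl
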